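/- Let $(S,\mathcal S)$ be a measurable space and let $(X_n)_{n\ge 0}$ be a (in general non-homogeneous) Markov chain on $S$ with one-step transition probability kernels $P_t$ (from time $t$ to time $t+1$), $t=0,1,2,\dots$. For $t\ge 0$, $m\ge 1$ write $\mathsf P_{t,x}(t+m,\cdot)$ for the law of $X_{t+m}$ given $X_t=x$, and $\mathsf P_{\mu}(n,\cdot)$ for the law of $X_n$ when $X_0$ has distribution $\mu$. For $x^1,x^2\in S$ put $$\alpha^{(m)}_t(x^1,x^2)=\int\Big(\frac{\mathsf P_{t,x^2}(t+m,dy)}{\mathsf P_{t,x^1}(t+m,dy)}\wedge 1\Big)\mathsf P_{t,x^1}(t+m,dy),$$ where the ratio denotes the density of the absolutely continuous component. Let $\Lambda=\frac12\big(\mathsf P_{t,x^1}(t+m,\cdot)+\mathsf P_{t,x^2}(t+m,\cdot)\big)$, let $p_i$ be the density of $\mathsf P_{t,x^i}(t+m,\cdot)$ with respect to $\Lambda$ ($i=1,2$), and, if $\alpha^{(m)}_t(x^1,x^2)<1$, let $\Phi^{(m)}_{t,i}(x^1,x^2;\cdot)$ be the probability measure with density $\dfrac{p_i-p_1\wedge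 p_2}{1-\alpha_t^{(m)}(x^1,x^2)}$ with respect to $\Lambda$; if $\alpha_t^{(m)}(x^1,x^2)=1$, let $\Phi^{(m)}_{t,1}=\Phi^{(m)}_{t,2}=\mathsf P_{t,x^1}(t+m,\cdot)$. Define the coupling operators on non-negative measurable functions $h$ on $S\times S$ by $$V^{(m)}_t h(x^1,x^2)=\big(1-\alpha_t^{(m)}(x^1,x^2)\big)\iint h(y^1,y^2)\,\Phi^{(m)}_{t,1}(x^1,x^2;dy^1)\,\Phi^{(m)}_{t,2}(x^1,x^2;dy^2).$$ Fix $m\ge 1$. Assume that the diagonal of $S\times S$ is measurable and that for every $t\ge 0$ and every $A\in\mathcal S$ the map $(x^1,x^2)\mapsto \int_A (p_1\wedge p_2)\,d\Lambda$ is measurable on $S\times S$ (both hold automatically if $\mathcal S$ is countably generated and contains all singletons). Then for all probability measures $\mu^1,\mu^2$ on $S$, $$\limsup_{n\to\infty}\frac1n\ln\big\|\mathsf P_{\mu^1}(n,\cdot)-\mathsf P_{\mu^2}(n,\cdot)\big\|_{TV}\le\limsup_{n\to\infty}\frac1{nm}\ln\iint\Big(\prod_{i=0}^{n-1}V^{(m)}_{im}\Big)\mathbf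 1(x^1,x^2)\,1(x^1\ne x^2)\,\mu^1(dx^1)\,\mu^2(dx^2),$$ where $\prod_{i=0}^{n-1}V^{(m)}_{im}=V^{(m)}_0V^{(m)}_mV^{(m)}_{2m}\cdots V^{(m)}_{(n-1)m}$ (in this order), $\|\cdot\|_{TV}$ is the total variation norm of a signed measure, and $\ln 0=-\infty$. -/

import Mathlib

open MeasureTheory ProbabilityTheory Filter
open scoped ENNReal

noncomputable section

namespace NonhomChain

variable {S : Type*} [MeasurableSpace S]

/-- `transition P t k x` is the law at time `t + k` of the non-homogeneous Markov chain which is in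
the state `x` at time `t`; here `P t` is the one-step transition kernel from time `t` to `t + 1`. -/
def transition (P : ℕ → Kernel S S) (t : ℕ) : ℕ → Kernel S S
  | 0 => Kernel.id
  | k + 1 => P (t + k) ∘ₖ transition P t k

instance transition_isMarkov (P : ℕ → Kernel S S) [∀ t, IsMarkovKernel (P t)] (t k : ℕ) :
    IsMarkovKernel (transition P t k) := by
  induction k with
  | zero => unfold transition; infer_instance
  | succ k ih => unfold transition; infer_instance

/-- The law at time `n` of the chain with initial measure `μ` (at time `0`). -/
def marginal (P : ℕ → Kernel S S) (μ : Measure S) (n : ℕ) : Measure S :=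
  transition P 0 n ∘ₘ μ

instance marginal_isProbability (P : ℕ → Kernel S S) [∀ t, IsMarkovKernel (P t)]
    (μ : Measure S) [IsProbabilityMeasure μ] (n : ℕ) : IsProbabilityMeasure (marginal P μ n) := by
  unfold marginal; infer_instance

/-- The total variation norm of the difference of two finite measures (total mass of the variation
of the signed measure `μ - ν`). -/
def tvNorm (μ ν : Measure S) [IsFiniteMeasure μ] [IsFiniteMeasure ν] : ℝ≥0∞ :=
  (μ.toSignedMeasure - ν.toSignedMeasure).totalVariation Set.univ

/-- The coefficient `α_t^{(m)}(x, x')`, the integral of `(dP_{t,x'}(t+m) / dP_{t,x}(t+m)) ∧ 1`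
against `P_{t,x}(t+m)`, the ratio being the density of the absolutely continuous component. -/
def alpha (P : ℕ → Kernel S S) (m t : ℕ) (x x' : S) : ℝ≥0∞ :=
  ∫⁻ y, min ((transition P t m x').rnDeriv (transition P t m x) y) 1 ∂(transition P t m x)

/-- The reference measure `Λ = (P_{t,x¹}(t+m) + P_{t,x²}(t+m)) / 2`. -/
def refMeasure (P : ℕ → Kernel S S) (m t : ℕ) (x1 x2 : S) : Measure S :=
  (2⁻¹ : ℝ≥0∞) • (transition P t m x1 + transition P t m x2)

/-- The density of `P_{t,x¹}(t+m)` with respect to `Λ`. -/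
def dens1 (P : ℕ → Kernel S S) (m t : ℕ) (x1 x2 : S) : S → ℝ≥0∞ :=
  (transition P t m x1).rnDeriv (refMeasure P m t x1 x2)

/-- The density of `P_{t,x²}(t+m)` with respect to `Λ`. -/
def dens2 (P : ℕ → Kernel S S) (m t : ℕ) (x1 x2 : S) : S → ℝ≥0∞ :=
  (transition P t m x2).rnDeriv (refMeasure P m t x1 x2)

/-- The common part `P_{t,x¹}(t+m) ∧ P_{t,x²}(t+m)`, with density `p(x¹,·) ∧ p(x²,·)`. -/
def commonPart (P : ℕ → Kernel S S) (m t : ℕ) (x1 x2 : S) : Measure S :=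
  (refMeasure P m t x1 x2).withDensity
    (fun u => min (dens1 P m t x1 x2 u) (dens2 P m t x1 x2 u))

open Classical in
/-- The law of `η¹_{t+m}` given `(η¹_t, η²_t) = (x¹, x²)`: density
`(p(x¹,·) - p(x¹,·) ∧ p(x²,·)) / (1 - α(x¹,x²))`; when `α(x¹,x²) = 1` (a case that never
contributes) it is `P_{t,x¹}(t+m)`. -/
def etaLaw1 (P : ℕ → Kernel S S) (m t : ℕ) (x1 x2 : S) : Measure S :=
  if alpha P m t x1 x2 = 1 then transition P t m x1 else
    (refMeasure P m t x1 x2).withDensity (fun u =>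
      (dens1 P m t x1 x2 u - min (dens1 P m t x1 x2 u) (dens2 P m t x1 x2 u))
        / (1 - alpha P m t x1 x2))

open Classical in
/-- The law of `η²_{t+m}` given `(η¹_t, η²_t) = (x¹, x²)`, with the same convention. -/
def etaLaw2 (P : ℕ → Kernel S S) (m t : ℕ) (x1 x2 : S) : Measure S :=
  if alpha P m t x1 x2 = 1 then transition P t m x1 else
    (refMeasure P m t x1 x2).withDensity (fun u =>
      (dens2 P m t x1 x2 u - min (dens1 P m t x1 x2 u) (dens2 P m t x1 x2 u))
        / (1 - alpha P m t x1 x2))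

/-- The joint law of the (conditionally independent) pair `(η¹_{t+m}, η²_{t+m})` given
`(η¹_t, η²_t) = x`: the transition law of the Markov coupling as long as it is not yet coupled. -/
def etaLaw (P : ℕ → Kernel S S) (m t : ℕ) (x : S × S) : Measure (S × S) :=
  (etaLaw1 P m t x.1 x.2).prod (etaLaw2 P m t x.1 x.2)

/-- The sub-Markov coupling operator
`V_t^{(m)} h(x) = (1 - α_t^{(m)}(x¹,x²)) E_{t,x} h(η¹_{t+m}, η²_{t+m})`, on `[0,∞]`-valued functions
on `S × S`. -/
def V (P : ℕ → Kernel S S) (m t : ℕ) (h : S × S → ℝ≥0∞) : S × S → ℝ≥0∞ :=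
  fun x => (1 - alpha P m t x.1 x.2) * ∫⁻ y, h y ∂(etaLaw P m t x)

/-- The ordered product `V_0^{(m)} V_m^{(m)} V_{2m}^{(m)} ⋯ V_{(n-1)m}^{(m)}`. -/
def prodV (P : ℕ → Kernel S S) (m : ℕ) : ℕ → (S × S → ℝ≥0∞) → (S × S → ℝ≥0∞)
  | 0 => id
  | n + 1 => prodV P m n ∘ V P m (n * m)

end NonhomChain

end

open MeasureTheory ProbabilityTheory Filter
open scoped ENNReal

namespace NonhomChain

variable {S : Type*} [MeasurableSpace S]

/-! ### Total variation -/

/-! The proof transports a pointwise inequality `g y¹ ≤ g y² + h (y¹, y²)` instead of constructing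
the coupled process. Both laws over a block are their common part plus `1 - α` times a residual law;
in the comparison the common part cancels and the product of the residuals leaves exactly `V h`
(`lintegral_transition_le_add_V`). Iterating from `h = 1` bounds the difference of the marginals on
every set by the integral of `prodV`, hence the norm by twice that. The time left over after `n`
blocks costs nothing, and the factor 2 disappears in the exponential rate
(`limsup_log_div_le_of_block`). -/

/-- A one-sided bound on all measurable sets controls the total variation norm. -/
theorem tvNorm_le_two_mul (μ ν : Measure S) [IsProbabilityMeasure μ] [IsProbabilityMeasure ν]
    {c : ℝ≥0∞} (h : ∀ A, MeasurableSet A → μ A ≤ ν A + c) : tvNorm μ ν ≤ 2 * c := by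
  set s : SignedMeasure S := μ.toSignedMeasure - ν.toSignedMeasure with hs
  obtain ⟨A, hA, hpos, hneg, hp, hn⟩ := s.toJordanDecomposition_spec
  -- Since `s` has total mass zero, both Jordan parts have the same mass, so bounding the positive
  -- part is enough; this is the origin of the factor 2.
  have hu : s.toJordanDecomposition.posPart.real Set.univ
      = s.toJordanDecomposition.negPart.real Set.univ := by
    have h1 := s.apply_eq_posPart_real_sub_negPart_real MeasurableSet.univ
    have h2 : s Set.univ = 0 := by
      rw [hs, Measure.toSignedMeasure_sub_apply MeasurableSet.univ]
      simp
    linarith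
  have hu' : s.toJordanDecomposition.negPart Set.univ
      = s.toJordanDecomposition.posPart Set.univ := by
    rw [← ENNReal.toReal_eq_toReal_iff' (measure_ne_top _ _) (measure_ne_top _ _)]
    exact hu.symm
  have hle : s.toJordanDecomposition.posPart Set.univ ≤ c := by
    have h3 : s.toJordanDecomposition.posPart.real Set.univ = μ.real A - ν.real A := by
      rw [hp, SignedMeasure.toMeasureOfZeroLE_real_apply _ hpos hA MeasurableSet.univ,
        Set.inter_univ, hs, Measure.toSignedMeasure_sub_apply hA]
    rw [← ENNReal.ofReal_toReal (measure_ne_top s.toJordanDecomposition.posPart Set.univ)]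
    change ENNReal.ofReal (s.toJordanDecomposition.posPart.real Set.univ) ≤ c
    rw [h3, ENNReal.ofReal_sub _ measureReal_nonneg, ofReal_measureReal, ofReal_measureReal]
    exact tsub_le_iff_left.2 (h A hA)
  unfold tvNorm SignedMeasure.totalVariation
  rw [← hs, Measure.add_apply, hu', two_mul]
  exact add_le_add hle hle

/-! ### Splitting a law into its common part and the remainder -/

-- Split the density as `p = r + (p - r)`; the factor `1 - a` undoes the normalisation. If `a = 1`,
-- then `p - r` vanishes a.e. and the choice of `κ` is irrelevant.
open Classical in
theorem lintegral_eq_add_residual {L μ κ : Measure S} [IsFiniteMeasure L] [IsProbabilityMeasure μ]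
    {p r : S → ℝ≥0∞} {a : ℝ≥0∞} (hp : Measurable p) (hr : Measurable r) (hrp : r ≤ p)
    (hμ : L.withDensity p = μ) (ha : ∫⁻ u, r u ∂L = a) (ha1 : a ≤ 1)
    {g : S → ℝ≥0∞} (hg : Measurable g) :
    ∫⁻ u, g u ∂μ = ∫⁻ u, g u ∂(L.withDensity r)
      + (1 - a) * ∫⁻ u, g u ∂(if a = 1 then κ else
          L.withDensity (fun u => (p u - r u) / (1 - a))) := by
  have hpr : Measurable fun u => p u - r u := hp.sub hr
  have hmass : ∫⁻ u, p u ∂L = 1 := by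
    rw [← setLIntegral_univ, ← withDensity_apply _ MeasurableSet.univ, hμ, measure_univ]
  have key : (1 - a) * ∫⁻ u, g u ∂(if a = 1 then κ else
      L.withDensity (fun u => (p u - r u) / (1 - a))) = ∫⁻ u, (p u - r u) * g u ∂L := by
    split_ifs with h
    · have h0 : ∫⁻ u, (p u - r u) ∂L = 0 := by
        rw [lintegral_sub hr (by rw [ha, h]; simp) (ae_of_all _ hrp), hmass, ha, h, tsub_self]
      rw [lintegral_eq_zero_iff hpr] at h0
      rw [h, tsub_self, zero_mul]
      refine (lintegral_eq_zero_of_ae_eq_zero ?_).symm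
      filter_upwards [h0] with u hu
      simp only [Pi.zero_apply] at hu ⊢
      rw [hu, zero_mul]
    · have h0 : 1 - a ≠ 0 := by
        rw [Ne, tsub_eq_zero_iff_le]
        exact fun h' => h (le_antisymm ha1 h')
      have ht : 1 - a ≠ ⊤ := ENNReal.sub_ne_top ENNReal.one_ne_top
      rw [lintegral_withDensity_eq_lintegral_mul _ (hpr.div_const _) hg,
        ← lintegral_const_mul _ ((hpr.div_const _).mul hg)]
      refine lintegral_congr fun u => ?_
      rw [Pi.mul_apply, ← mul_assoc, ENNReal.mul_div_cancel h0 ht]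
  rw [key, lintegral_withDensity_eq_lintegral_mul _ hr hg, ← lintegral_add_left (hr.mul hg), ← hμ,
    lintegral_withDensity_eq_lintegral_mul _ hp hg]
  refine lintegral_congr fun u => ?_
  rw [Pi.mul_apply, Pi.mul_apply, ← add_mul, add_tsub_cancel_of_le (hrp u)]

theorem eq_one_of_one_eq_add_one_sub_mul {a b : ℝ≥0∞} (ha : a ≤ 1) (hne : a ≠ 1)
    (h : 1 = a + (1 - a) * b) : b = 1 := by
  have h0 : 1 - a ≠ 0 := by
    rw [Ne, tsub_eq_zero_iff_le]
    exact fun h' => hne (le_antisymm ha h')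
  have ht : 1 - a ≠ ⊤ := ENNReal.sub_ne_top ENNReal.one_ne_top
  have hat : a ≠ ⊤ := ne_top_of_le_ne_top ENNReal.one_ne_top ha
  have h1 : a + (1 - a) * b = a + (1 - a) * 1 := by
    rw [← h, mul_one, add_tsub_cancel_of_le ha]
  exact (ENNReal.mul_right_inj h0 ht).1 ((ENNReal.add_right_inj hat).1 h1)

variable (P : ℕ → Kernel S S) (m t : ℕ) (x1 x2 : S)

theorem transition_add (k l : ℕ) :
    transition P t (k + l) = transition P (t + k) l ∘ₖ transition P t k := by
  induction l with
  | zero => simp [transition, Kernel.id_comp]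
  | succ l ih =>
    rw [← add_assoc, transition, ih, transition, ← Kernel.comp_assoc, add_assoc]

theorem lintegral_transition_add (k l : ℕ) (x : S) {g : S → ℝ≥0∞} (hg : Measurable g) :
    ∫⁻ u, g u ∂(transition P t (k + l) x)
      = ∫⁻ y, ∫⁻ u, g u ∂(transition P (t + k) l y) ∂(transition P t k x) := by
  rw [transition_add, Kernel.lintegral_comp _ _ _ hg]

theorem transition_absolutelyContinuous_left :
    transition P t m x1 ≪ refMeasure P m t x1 x2 :=
  (Measure.AbsolutelyContinuous.rfl.add_right _).smul_right (by simp)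

theorem transition_absolutelyContinuous_right :
    transition P t m x2 ≪ refMeasure P m t x1 x2 := by
  unfold refMeasure
  rw [add_comm]
  exact (Measure.AbsolutelyContinuous.rfl.add_right _).smul_right (by simp)

variable [∀ t, IsMarkovKernel (P t)]

instance refMeasure_isFinite : IsFiniteMeasure (refMeasure P m t x1 x2) := by
  unfold refMeasure
  exact Measure.smul_finite _ (by simp)

/-- The density ratio is `p₂ / p₁` almost everywhere for the first law, and `p₁ * min (p₂ / p₁) 1 =
min p₁ p₂`, also where `p₁ = 0`. -/
theorem alpha_eq_lintegral_min : alpha P m t x1 x2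
    = ∫⁻ u, min (dens1 P m t x1 x2 u) (dens2 P m t x1 x2 u) ∂(refMeasure P m t x1 x2) := by
  have h1 := transition_absolutelyContinuous_left P m t x1 x2
  have h2 := transition_absolutelyContinuous_right P m t x1 x2
  have hm1 : Measurable (dens1 P m t x1 x2) := Measure.measurable_rnDeriv _ _
  have hm2 : Measurable (dens2 P m t x1 x2) := Measure.measurable_rnDeriv _ _
  have hae : ∀ᵐ u ∂(transition P t m x1),
      min ((transition P t m x2).rnDeriv (transition P t m x1) u) 1
        = min (dens2 P m t x1 x2 u / dens1 P m t x1 x2 u) 1 := by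
    filter_upwards [Measure.rnDeriv_eq_div h2 h1] with u hu
    rw [hu]; rfl
  unfold alpha
  rw [lintegral_congr_ae hae, ← lintegral_rnDeriv_mul h1
    (f := fun u => min (dens2 P m t x1 x2 u / dens1 P m t x1 x2 u) 1)
    ((hm2.div hm1).min measurable_const).aemeasurable]
  refine lintegral_congr_ae ?_
  filter_upwards [Measure.rnDeriv_lt_top (transition P t m x1) (refMeasure P m t x1 x2)] with u hu
  change dens1 P m t x1 x2 u * _ = _
  have hu' : dens1 P m t x1 x2 u ≠ ⊤ := hu.ne
  by_cases h0 : dens1 P m t x1 x2 u = 0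
  · simp [h0]
  · rw [mul_min, mul_one, ENNReal.mul_div_cancel h0 hu', min_comm]

theorem alpha_le_one : alpha P m t x1 x2 ≤ 1 := by
  calc alpha P m t x1 x2 ≤ ∫⁻ _, 1 ∂(transition P t m x1) :=
        lintegral_mono fun _ => min_le_right _ _
    _ = 1 := by simp

theorem commonPart_univ : commonPart P m t x1 x2 Set.univ = alpha P m t x1 x2 := by
  rw [commonPart, withDensity_apply _ MeasurableSet.univ, setLIntegral_univ,
    alpha_eq_lintegral_min]

theorem lintegral_transition_left {g : S → ℝ≥0∞} (hg : Measurable g) :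
    ∫⁻ u, g u ∂(transition P t m x1) = ∫⁻ u, g u ∂(commonPart P m t x1 x2)
      + (1 - alpha P m t x1 x2) * ∫⁻ u, g u ∂(etaLaw1 P m t x1 x2) :=
  lintegral_eq_add_residual (Measure.measurable_rnDeriv _ _)
    ((Measure.measurable_rnDeriv _ _).min (Measure.measurable_rnDeriv _ _))
    (fun _ => min_le_left _ _)
    (Measure.withDensity_rnDeriv_eq _ _ (transition_absolutelyContinuous_left P m t x1 x2))
    (alpha_eq_lintegral_min P m t x1 x2).symm (alpha_le_one P m t x1 x2) hg

theorem lintegral_transition_right {g : S → ℝ≥0∞} (hg : Measurable g) :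
    ∫⁻ u, g u ∂(transition P t m x2) = ∫⁻ u, g u ∂(commonPart P m t x1 x2)
      + (1 - alpha P m t x1 x2) * ∫⁻ u, g u ∂(etaLaw2 P m t x1 x2) :=
  lintegral_eq_add_residual (Measure.measurable_rnDeriv _ _)
    ((Measure.measurable_rnDeriv _ _).min (Measure.measurable_rnDeriv _ _))
    (fun _ => min_le_right _ _)
    (Measure.withDensity_rnDeriv_eq _ _ (transition_absolutelyContinuous_right P m t x1 x2))
    (alpha_eq_lintegral_min P m t x1 x2).symm (alpha_le_one P m t x1 x2) hg

instance etaLaw1_isProbability : IsProbabilityMeasure (etaLaw1 P m t x1 x2) := by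
  by_cases h : alpha P m t x1 x2 = 1
  · rw [etaLaw1, if_pos h]; infer_instance
  · refine ⟨eq_one_of_one_eq_add_one_sub_mul (alpha_le_one P m t x1 x2) h ?_⟩
    simpa [commonPart_univ] using
      lintegral_transition_left P m t x1 x2 (measurable_const (a := (1 : ℝ≥0∞)))

instance etaLaw2_isProbability : IsProbabilityMeasure (etaLaw2 P m t x1 x2) := by
  by_cases h : alpha P m t x1 x2 = 1
  · rw [etaLaw2, if_pos h]; infer_instance
  · refine ⟨eq_one_of_one_eq_add_one_sub_mul (alpha_le_one P m t x1 x2) h ?_⟩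
    simpa [commonPart_univ] using
      lintegral_transition_right P m t x1 x2 (measurable_const (a := (1 : ℝ≥0∞)))

/-! ### Coupling inequality -/

/-- Integrating a pointwise bound `g y¹ ≤ g y² + h (y¹, y²)` against a product measure. -/
theorem lintegral_le_add_prod {μ ν : Measure S} [IsProbabilityMeasure μ] [IsProbabilityMeasure ν]
    {g : S → ℝ≥0∞} (hg : Measurable g) {h : S × S → ℝ≥0∞}
    (hgh : ∀ y : S × S, g y.1 ≤ g y.2 + h y) :
    ∫⁻ u, g u ∂μ ≤ ∫⁻ u, g u ∂ν + ∫⁻ y, h y ∂(μ.prod ν) := by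
  calc ∫⁻ u, g u ∂μ = ∫⁻ y, g y.1 ∂(μ.prod ν) :=
        (measurePreserving_fst.lintegral_comp hg).symm
    _ ≤ ∫⁻ y, (g y.2 + h y) ∂(μ.prod ν) := lintegral_mono hgh
    _ = ∫⁻ u, g u ∂ν + ∫⁻ y, h y ∂(μ.prod ν) := by
        -- Additivity needs only one measurable summand, here `g`, so `h` may be arbitrary.
        rw [lintegral_add_left (f := fun y : S × S => g y.2) (hg.comp measurable_snd),
          measurePreserving_snd.lintegral_comp hg]

theorem lintegral_transition_le_add_V {g : S → ℝ≥0∞} (hg : Measurable g) {h : S × S → ℝ≥0∞}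
    (hgh : ∀ y : S × S, g y.1 ≤ g y.2 + h y) (x : S × S) :
    ∫⁻ u, g u ∂(transition P t m x.1) ≤ ∫⁻ u, g u ∂(transition P t m x.2) + V P m t h x := by
  rw [lintegral_transition_left P m t x.1 x.2 hg, lintegral_transition_right P m t x.1 x.2 hg,
    V, etaLaw, add_assoc, ← mul_add]
  gcongr
  exact lintegral_le_add_prod hg hgh

theorem lintegral_transition_le_add_prodV (n : ℕ) {g : S → ℝ≥0∞} (hg : Measurable g)
    {h : S × S → ℝ≥0∞} (hgh : ∀ y : S × S, g y.1 ≤ g y.2 + h y) (x : S × S) :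
    ∫⁻ u, g u ∂(transition P 0 (n * m) x.1)
      ≤ ∫⁻ u, g u ∂(transition P 0 (n * m) x.2) + prodV P m n h x := by
  induction n generalizing g h with
  | zero =>
    simpa [transition, prodV, Kernel.id_apply, lintegral_dirac' _ hg] using hgh x
  | succ n ih =>
    rw [Nat.succ_mul, lintegral_transition_add P 0 _ _ _ hg, lintegral_transition_add P 0 _ _ _ hg,
      zero_add]
    -- The last block in time is the innermost operator of `prodV`: peeling it off replaces `g` by
    -- its integral over that block and `h` by `V h`.
    exact ih hg.lintegral_kernel (lintegral_transition_le_add_V P m (n * m) hg hgh)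

theorem alpha_self (x : S) : alpha P m t x x = 1 := by
  unfold alpha
  have h : ∀ᵐ y ∂(transition P t m x),
      min ((transition P t m x).rnDeriv (transition P t m x) y) 1 = 1 := by
    filter_upwards [Measure.rnDeriv_self (transition P t m x)] with y hy
    simp [hy]
  rw [lintegral_congr_ae h]
  simp

/-- The outermost operator, at time 0, carries the factor `1 - α(x, x) = 0`. -/
theorem prodV_diagonal {n : ℕ} (hn : n ≠ 0) (h : S × S → ℝ≥0∞) (x : S) :
    prodV P m n h (x, x) = 0 := by
  obtain ⟨n, rfl⟩ := Nat.exists_eq_succ_of_ne_zero hn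
  clear hn
  induction n generalizing h with
  | zero => simp [prodV, V, alpha_self]
  | succ n ih => exact ih (V P m ((n + 1) * m) h)

theorem indicator_prodV {n : ℕ} (hn : n ≠ 0) (h : S × S → ℝ≥0∞) :
    (Set.diagonal S)ᶜ.indicator (prodV P m n h) = prodV P m n h := by
  rw [Set.indicator_eq_self]
  rintro ⟨x, y⟩ hxy hd
  obtain rfl : x = y := hd
  exact hxy (prodV_diagonal P m hn h x)

theorem marginal_apply_le (μ1 μ2 : Measure S) [IsProbabilityMeasure μ1] [IsProbabilityMeasure μ2]
    (n r : ℕ) {A : Set S} (hA : MeasurableSet A) :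
    marginal P μ1 (n * m + r) A ≤ marginal P μ2 (n * m + r) A
      + ∫⁻ x, prodV P m n (fun _ => 1) x ∂(μ1.prod μ2) := by
  have hb (y : S) : transition P (n * m) r y A ≤ 1 := prob_le_one
  have hk (x : S) : transition P 0 (n * m + r) x A
      = ∫⁻ y, transition P (n * m) r y A ∂(transition P 0 (n * m) x) := by
    rw [transition_add, zero_add, Kernel.comp_apply' _ _ _ hA]
  rw [marginal, marginal, Measure.bind_apply hA (Kernel.aemeasurable _),
    Measure.bind_apply hA (Kernel.aemeasurable _)]
  refine lintegral_le_add_prod (Kernel.measurable_coe _ hA) fun x => ?_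
  rw [hk, hk]
  -- The last `r` steps are absorbed into `g`, the probability of ending in `A`; since `g ≤ 1`, `h =
  -- 1` is admissible.
  exact lintegral_transition_le_add_prodV P m n (Kernel.measurable_coe _ hA)
    (fun y => (hb _).trans le_add_self) x

theorem tvNorm_marginal_le (μ1 μ2 : Measure S) [IsProbabilityMeasure μ1]
    [IsProbabilityMeasure μ2] {n : ℕ} (hn : n ≠ 0) (r : ℕ) :
    tvNorm (marginal P μ1 (n * m + r)) (marginal P μ2 (n * m + r))
      ≤ 2 * ∫⁻ x, (Set.diagonal S)ᶜ.indicator (prodV P m n (fun _ => 1)) x ∂(μ1.prod μ2) := by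
  rw [indicator_prodV P m hn]
  exact tvNorm_le_two_mul _ _ fun A hA => marginal_apply_le P m μ1 μ2 n r hA

/-! ### Exponential rates -/

theorem limsup_log_div_le_of_le {f : ℕ → ℝ≥0∞} {b c : ℝ}
    (h : ∀ᶠ k in atTop, ENNReal.log (f k) ≤ ((b + c * k : ℝ) : EReal)) :
    limsup (fun k => ENNReal.log (f k) / (k : EReal)) atTop ≤ c := by
  have ht : Tendsto (fun k : ℕ => ((b / k + c : ℝ) : EReal)) atTop (nhds (c : EReal)) := by
    refine (continuous_coe_real_ereal.tendsto c).comp ?_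
    simpa using (tendsto_const_div_atTop_nhds_zero_nat b).add_const c
  rw [← ht.limsup_eq]
  refine limsup_le_limsup ?_
  filter_upwards [h, eventually_gt_atTop 0] with k hk hk0
  have hkr : (0 : ℝ) < k := by exact_mod_cast hk0
  refine (EReal.div_le_div_right_of_nonneg (by positivity) hk).trans_eq ?_
  rw [← EReal.coe_coe_eq_natCast, ← EReal.coe_div]
  congr 1
  field_simp

/-- Comparing exponential rates along blocks of length `m`. -/
theorem limsup_log_div_le_of_block {f I : ℕ → ℝ≥0∞} {m : ℕ} (hm : 1 ≤ m) (hf : ∀ k, f k ≤ 2)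
    (hI : ∀ n r, n ≠ 0 → f (n * m + r) ≤ 2 * I n) :
    limsup (fun k => ENNReal.log (f k) / (k : EReal)) atTop
      ≤ limsup (fun n => ENNReal.log (I n) / ((n * m : ℕ) : EReal)) atTop := by
  have hlog2 : ENNReal.log 2 = ((Real.log 2 : ℝ) : EReal) := by
    simpa using ENNReal.log_ofReal_of_pos (x := 2) two_pos
  refine EReal.le_of_forall_lt_iff_le.1 fun c hc => ?_
  rcases le_or_gt 0 c with h0 | h0
  · refine limsup_log_div_le_of_le (b := Real.log 2) (Eventually.of_forall fun k => ?_)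
    refine (ENNReal.log_monotone (hf k)).trans ?_
    rw [hlog2, EReal.coe_le_coe_iff]
    have : 0 ≤ c * k := by positivity
    linarith
  · refine limsup_log_div_le_of_le (b := Real.log 2 - c * m) ?_
    have hev := eventually_lt_of_limsup_lt hc
    have hdiv : Tendsto (fun k : ℕ => k / m) atTop atTop := Nat.tendsto_div_const_atTop (by omega)
    filter_upwards [hdiv.eventually hev, hdiv.eventually (eventually_gt_atTop 0)] with k hk hk0
    have hkm : k / m * m + k % m = k := Nat.div_add_mod' k m
    have h1 : f k ≤ 2 * I (k / m) := by
      simpa only [hkm] using hI (k / m) (k % m) hk0.ne'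
    have hpos : 0 < k / m * m := Nat.mul_pos hk0 hm
    have h2 : ENNReal.log (I (k / m)) ≤ ((c * (k / m * m : ℕ) : ℝ) : EReal) := by
      rw [EReal.div_lt_iff (by exact_mod_cast hpos) (EReal.natCast_ne_top _)] at hk
      refine hk.le.trans_eq ?_
      rw [EReal.coe_mul, EReal.coe_coe_eq_natCast]
    calc ENNReal.log (f k) ≤ ENNReal.log (2 * I (k / m)) := ENNReal.log_monotone h1
      _ = (Real.log 2 : ℝ) + ENNReal.log (I (k / m)) := by rw [ENNReal.log_mul_add, hlog2]
      _ ≤ (Real.log 2 : ℝ) + ((c * (k / m * m : ℕ) : ℝ) : EReal) := by gcongr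
      _ ≤ ((Real.log 2 - c * m + c * k : ℝ) : EReal) := by
        rw [← EReal.coe_add, EReal.coe_le_coe_iff]
        have h3 : (k : ℝ) ≤ (k / m * m : ℕ) + m := by
          have := Nat.mod_lt k hm
          exact_mod_cast (by omega : k ≤ k / m * m + m)
        nlinarith [mul_nonneg (neg_nonneg.2 h0.le) (sub_nonneg.2 h3)]

end NonhomChain

/-- `P t` are the one-step transition kernels, `μ1`, `μ2` the initial measures. `hdiag` and `hmeas`
are the measurability in the pair of states that the integrals require; both are automatic for a
countably generated sigma-algebra that contains the singletons. `ENNReal.log 0 = ⊥`. -/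
theorem mainTheorem3 {S : Type*} [MeasurableSpace S]
    (P : ℕ → Kernel S S) [∀ t, IsMarkovKernel (P t)]
    (m : ℕ) (hm : 1 ≤ m)
    (hdiag : MeasurableSet (Set.diagonal S))
    (hmeas : ∀ (t : ℕ) (A : Set S), MeasurableSet A →
      Measurable (fun x : S × S => NonhomChain.commonPart P m t x.1 x.2 A))
    (μ1 μ2 : Measure S) [IsProbabilityMeasure μ1] [IsProbabilityMeasure μ2] :
    limsup (fun n : ℕ =>
        ENNReal.log (NonhomChain.tvNorm (NonhomChain.marginal P μ1 n)
          (NonhomChain.marginal P μ2 n)) / (n : EReal)) atTop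
      ≤ limsup (fun n : ℕ =>
        ENNReal.log (∫⁻ x, (Set.diagonal S)ᶜ.indicator
          (NonhomChain.prodV P m n (fun _ => 1)) x ∂(μ1.prod μ2)) / ((n * m : ℕ) : EReal)) atTop := by
  refine NonhomChain.limsup_log_div_le_of_block hm (fun k => ?_) fun n r hn =>
    NonhomChain.tvNorm_marginal_le P m μ1 μ2 hn r
  simpa using NonhomChain.tvNorm_le_two_mul (NonhomChain.marginal P μ1 k)
    (NonhomChain.marginal P μ2 k) (c := 1) fun A _ => prob_le_one.trans le_add_self
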